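/- Let $\mathcal A$ be a (complex, not necessarily unital) C*-algebra, let $\mathcal B$ be a C*-subalgebra of $\mathcal A$ (that is, a norm-closed $*$-subalgebra), and let $L$ be the pull-back to $\mathcal A$ of the quotient norm on $\mathcal A/\mathcal B$, that is, the seminorm $$L(A) = \inf\{\|A-B\| : B \in \mathcal B\}, \qquad A \in \mathcal A .$$ Assume that $\mathcal B$ contains a bounded approximate identity for $\mathcal A$, that is, there is a norm-bounded net $(E_\lambda)$ in $\mathcal B$ such that $\|E_\lambda A - A\| \to 0$ and $\|A E_\lambda - A\| \to 0$ for every $A \in \mathcal A$. Then $L$ is Leibniz, that is, $$L(AC) \le L(A)\|C\| + \|A\|L(C) \quad\text{for all } A, C \in \mathcal A .$$ If $\mathcal A$ is unital and $1_{\mathcal A} \in \mathcal B$, then $L$ is strongly Leibniz, that is, $L$ is Leibniz, $L(1_{\mathcal A}) = 0$, and for every $A$ that is invertible in $\mathcal A$, $$L(A^{-1}) \le \|A^{-1}\|^2 L(A) .$$ -/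

import Mathlib

/-- `B` contains a bounded approximate identity for `A`. The net is encoded by a (nontrivial)
filter on `A` along which `a * e → a` and `e * a → a` for every `a : A`, and which is supported
on a norm-bounded set of elements of `B`. -/
def ContainsBoundedApproxIdentity {A : Type*} [NonUnitalCStarAlgebra A]
    (B : NonUnitalStarSubalgebra ℂ A) : Prop :=
  ∃ l : Filter A, l.IsApproximateUnit ∧ ∃ M : ℝ, ∀ᶠ e in l, e ∈ B ∧ ‖e‖ ≤ M

/-- The quotient seminorm of `A / B` pulled back to `A`: `L a = inf {‖a - b‖ : b ∈ B}`. -/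
noncomputable def quotientSeminorm {A : Type*} [NonUnitalCStarAlgebra A]
    (B : NonUnitalStarSubalgebra ℂ A) : Seminorm ℂ A :=
  Seminorm.ofSMulLE (fun a : A => ⨅ b : B, ‖a - (b : A)‖)
    (le_antisymm
      (ciInf_le_of_le ⟨0, Set.forall_mem_range.2 fun _ => norm_nonneg _⟩ (0 : B) (by simp))
      (le_ciInf fun _ => norm_nonneg _))
    (fun x y => le_ciInf_add_ciInf fun b c =>
      ciInf_le_of_le ⟨0, Set.forall_mem_range.2 fun _ => norm_nonneg _⟩ (b + c) (by
        have h : x + y - ((b + c : B) : A) = (x - b) + (y - c) := by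
          push_cast
          abel
        rw [h]
        exact norm_add_le _ _))
    (fun r x => by
      rw [Real.mul_iInf_of_nonneg (norm_nonneg r)]
      exact le_ciInf fun b =>
        ciInf_le_of_le ⟨0, Set.forall_mem_range.2 fun _ => norm_nonneg _⟩ (r • b) (by
          rw [← norm_smul, smul_sub]
          exact le_rfl))

theorem quotientSeminorm_apply {A : Type*} [NonUnitalCStarAlgebra A]
    (B : NonUnitalStarSubalgebra ℂ A) (a : A) :
    quotientSeminorm B a = ⨅ b : B, ‖a - (b : A)‖ := rfl

/-- A seminorm on a C⋆-algebra is Leibniz. -/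
def IsLeibniz {A : Type*} [NonUnitalCStarAlgebra A] (L : Seminorm ℂ A) : Prop :=
  ∀ a c : A, L (a * c) ≤ L a * ‖c‖ + ‖a‖ * L c

/-- A seminorm on a unital C⋆-algebra is strongly Leibniz. -/
structure IsStronglyLeibniz {A : Type*} [CStarAlgebra A] (L : Seminorm ℂ A) : Prop where
  isLeibniz : IsLeibniz L
  map_one : L 1 = 0
  map_inv_le : ∀ u : Aˣ, L (↑u⁻¹ : A) ≤ ‖(↑u⁻¹ : A)‖ ^ 2 * L (u : A)

-- `L a` is the largest value of ‖[p, π(a)]‖ over ⋆-representations π and projections p commuting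
-- with π(B). Since [p, ·] is a derivation, the Leibniz rule and the bound for inverses follow. No
-- commutator exceeds `L a`: [p, π(a)] is unchanged when some b ∈ B is subtracted from a, and [p, ·]
-- is contractive (`norm_commutator_le_quotientSeminorm`). For attainment
-- (`exists_rep_quotientSeminorm_le`), Hahn–Banach gives a contractive ψ vanishing on B with ψ(a) =
-- `L a`. Write ψ = ⟨η, π(·)ξ⟩ with ξ, η in the unit ball, and let p project onto the closure of
-- π(B)ξ. Then η is orthogonal to the range of p and the approximate identity gives π(a)pξ = π(a)ξ,
-- so ⟨η, [p, π(a)]pξ⟩ = -`L a`.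

universe u

open scoped ComplexOrder

/-! ### Dominating a contractive functional by a positive one. -/

section Domination

variable {A : Type*} [CStarAlgebra A] [PartialOrder A] [StarOrderedRing A]

/-- Joint convexity of (x, s) ↦ x⋆x / s; it makes `dominationCone` closed under addition. It rests
on st|x+y|² + |tx-sy|² = (s+t)(t|x|² + s|y|²), where |z|² = z⋆z. -/
theorem star_add_mul_add_le {x y h k : A} {s t : ℝ} (hs : 0 ≤ s) (ht : 0 ≤ t)
    (hh : 0 ≤ h) (hk : 0 ≤ k) (hx : star x * x ≤ s • h) (hy : star y * y ≤ t • k) :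
    star (x + y) * (x + y) ≤ (s + t) • (h + k) := by
  rcases hs.eq_or_lt with rfl | hs'
  · have : x = 0 := by
      rw [zero_smul] at hx
      exact CStarRing.star_mul_self_eq_zero_iff x |>.1 (hx.antisymm (star_mul_self_nonneg x))
    subst this
    simp only [zero_add]
    exact hy.trans (smul_le_smul_of_nonneg_left (le_add_of_nonneg_left hh) ht)
  rcases ht.eq_or_lt with rfl | ht'
  · have : y = 0 := by
      rw [zero_smul] at hy
      exact CStarRing.star_mul_self_eq_zero_iff y |>.1 (hy.antisymm (star_mul_self_nonneg y))
    subst this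
    simp only [add_zero]
    exact hx.trans (smul_le_smul_of_nonneg_left (le_add_of_nonneg_right hk) hs)
  have h0 : 0 ≤ star (t • x - s • y) * (t • x - s • y) := star_mul_self_nonneg _
  have h1 : (s * t) • (star (x + y) * (x + y)) + star (t • x - s • y) * (t • x - s • y)
      = ((s + t) * t) • (star x * x) + ((s + t) * s) • (star y * y) := by
    simp only [star_add, star_sub, star_smul, star_trivial, add_mul, mul_add, sub_mul, mul_sub,
      smul_mul_assoc, mul_smul_comm]
    module
  have h2 : ((s + t) * t) • (star x * x) ≤ ((s + t) * t) • (s • h) :=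
    smul_le_smul_of_nonneg_left hx (by positivity)
  have h3 : ((s + t) * s) • (star y * y) ≤ ((s + t) * s) • (t • k) :=
    smul_le_smul_of_nonneg_left hy (by positivity)
  have h4 : (s * t) • (star (x + y) * (x + y)) ≤ (s * t) • ((s + t) • (h + k)) := by
    calc _ ≤ ((s + t) * t) • (star x * x) + ((s + t) * s) • (star y * y) := by
          rw [← h1]; exact le_add_of_nonneg_right h0
      _ ≤ _ := add_le_add h2 h3
      _ = _ := by module
  exact le_of_smul_le_smul_left h4 (by positivity)

/-- The cone of pairs `(h, r)` on which `(h, r) ↦ φ h + r` has to be nonnegative for `φ` to be a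
positive functional with `φ 1 ≤ 1` and `‖ψ a‖ ^ 2 ≤ φ (star a * a)`. -/
noncomputable def dominationCone (ψ : StrongDual ℂ A) : PointedCone ℝ (selfAdjoint A × ℝ) where
  -- Put k = h + (r + s)1. If φ 1 = 1, then φ h + r = φ k - s, and s² = |ψ x|² ≤ φ(x⋆x) ≤ s φ k
  -- makes this nonnegative.
  carrier := {p | ∃ (s : ℝ) (x : A), 0 ≤ s ∧ ψ x = s ∧ 0 ≤ (p.1 : A) + (p.2 + s) • (1 : A) ∧
    star x * x ≤ s • ((p.1 : A) + (p.2 + s) • (1 : A))}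
  zero_mem' := ⟨0, 0, by simp⟩
  add_mem' := by
    rintro ⟨h, r⟩ ⟨k, q⟩ ⟨s, x, hs, hψx, hh, hx⟩ ⟨t, y, ht, hψy, hk, hy⟩
    have e : ((h + k : selfAdjoint A) : A) + ((r + q) + (s + t)) • (1 : A)
        = (h + (r + s) • (1 : A)) + (k + (q + t) • (1 : A)) := by
      push_cast
      module
    refine ⟨s + t, x + y, add_nonneg hs ht, by simp [hψx, hψy], ?_, ?_⟩
    · simp only [Prod.mk_add_mk, e]
      exact add_nonneg hh hk
    · simp only [Prod.mk_add_mk, e]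
      exact star_add_mul_add_le hs ht hh hk hx hy
  smul_mem' := by
    rintro ⟨c, hc⟩ ⟨h, r⟩ ⟨s, x, hs, hψx, hh, hx⟩
    have e : ((c • h : selfAdjoint A) : A) + (c • r + c * s) • (1 : A)
        = c • (h + (r + s) • (1 : A)) := by
      rw [selfAdjoint.val_smul, smul_eq_mul]
      module
    refine ⟨c * s, c • x, mul_nonneg hc hs, ?_, ?_, ?_⟩
    · rw [← Complex.coe_smul, map_smul, hψx]; simp
    · change 0 ≤ ((c • h : selfAdjoint A) : A) + (c • r + c * s) • (1 : A)
      rw [e]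
      exact smul_nonneg hc hh
    · change _ ≤ (c * s) • (((c • h : selfAdjoint A) : A) + (c • r + c * s) • (1 : A))
      rw [e]
      have := smul_le_smul_of_nonneg_left hx (mul_nonneg hc hc)
      calc _ = (c * c) • (star x * x) := by
            simp only [star_smul, star_trivial, smul_mul_assoc, mul_smul_comm, smul_smul]
        _ ≤ _ := this
        _ = _ := by module

theorem mem_dominationCone {ψ : StrongDual ℂ A} {p : selfAdjoint A × ℝ} :
    p ∈ dominationCone ψ ↔ ∃ (s : ℝ) (x : A), 0 ≤ s ∧ ψ x = s ∧
      0 ≤ (p.1 : A) + (p.2 + s) • (1 : A) ∧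
      star x * x ≤ s • ((p.1 : A) + (p.2 + s) • (1 : A)) := Iff.rfl

/-- Contractivity of ψ enters here: s² ≤ ‖x‖² ≤ s(r + s). -/
theorem nonneg_of_zero_mem_dominationCone [Nontrivial A] {ψ : StrongDual ℂ A} (hψ : ‖ψ‖ ≤ 1)
    {r : ℝ} (hr : ((0 : selfAdjoint A), r) ∈ dominationCone ψ) : 0 ≤ r := by
  obtain ⟨s, x, hs, hψx, h0, hx⟩ := mem_dominationCone.1 hr
  simp only [ZeroMemClass.coe_zero, zero_add, ← Algebra.algebraMap_eq_smul_one] at h0 hx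
  have h0' : 0 ≤ r + s := 
    spectrum_nonneg_of_nonneg h0 (by rw [spectrum.scalar_eq]; rfl)
  have hn : ‖x‖ * ‖x‖ ≤ s * (r + s) := by
    rw [← CStarRing.norm_star_mul_self]
    refine (CStarAlgebra.norm_le_norm_of_nonneg_of_le (star_mul_self_nonneg x) hx).trans ?_
    rw [norm_smul, norm_algebraMap', Real.norm_of_nonneg hs, Real.norm_of_nonneg h0']
  have hsx : s ≤ ‖x‖ := by
    have := ψ.le_of_opNorm_le hψ x
    rwa [hψx, one_mul, Complex.norm_real, Real.norm_of_nonneg hs] at this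
  rcases hs.eq_or_lt with rfl | hs'
  · simpa using h0'
  · nlinarith

/-- A contractive functional on a unital C⋆-algebra is dominated by a positive functional. -/
theorem exists_positiveLinearMap_norm_sq_le (ψ : StrongDual ℂ A) (hψ : ‖ψ‖ ≤ 1) :
    ∃ φ : A →ₚ[ℂ] ℂ, (φ 1).re ≤ 1 ∧ ∀ a, ‖ψ a‖ ^ 2 ≤ (φ (star a * a)).re := by
  rcases subsingleton_or_nontrivial A with _ | _
  · exact ⟨0, by simp, fun a => by simp [Subsingleton.elim a 0]⟩
  let f : (selfAdjoint A × ℝ) →ₗ.[ℝ] ℝ :=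
    ⟨LinearMap.ker (LinearMap.fst ℝ (selfAdjoint A) ℝ),
      LinearMap.snd ℝ (selfAdjoint A) ℝ ∘ₗ Submodule.subtype _⟩
  -- M. Riesz extension of (0, r) ↦ r, keeping nonnegativity on the cone.
  obtain ⟨g, hgf, hg⟩ := riesz_extension (dominationCone ψ) f
    (by
      rintro ⟨⟨h, r⟩, hr⟩ hmem
      obtain rfl : h = 0 := hr
      exact nonneg_of_zero_mem_dominationCone hψ hmem)
    (by
      rintro ⟨h, r⟩
      refine ⟨⟨(0, ‖(h : A)‖ - r), LinearMap.mem_ker.2 rfl⟩, mem_dominationCone.2 ⟨0, 0, le_rfl, by simp, ?_⟩⟩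
      have : 0 ≤ (h : A) + ‖(h : A)‖ • (1 : A) := by
        have := h.2.neg_algebraMap_norm_le_self
        rw [Algebra.algebraMap_eq_smul_one] at this
        simpa [neg_le_iff_add_nonneg] using this
      simpa using this)
  have hg0 (r : ℝ) : g (0, r) = r := hgf ⟨(0, r), LinearMap.mem_ker.2 rfl⟩
  have hsplit (h : selfAdjoint A) (r : ℝ) : g (h, r) = g (h, 0) + r := by
    rw [← hg0 r, ← map_add]
    simp [hg0]
  let φr : Module.Dual ℝ A := g ∘ₗ LinearMap.inl ℝ (selfAdjoint A) ℝ ∘ₗ realPart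
  have hφr (h : selfAdjoint A) : φr h = g (h, 0) := by
    simp [φr]
  have hre (x : A) : (φr.extendRCLike x : ℂ).re = φr x :=
    Module.Dual.re_extendRCLike_apply (𝕜 := ℂ) φr x
  have him (h : selfAdjoint A) : (φr.extendRCLike (h : A) : ℂ).im = 0 := by
    refine (Module.Dual.im_extendRCLike_apply (𝕜 := ℂ) φr (h : A)).trans ?_
    simp [φr, realPart_I_smul, hg0]
  refine ⟨PositiveLinearMap.mk₀ (φr.extendRCLike) fun x hx => ?_, ?_, fun a => ?_⟩
  · lift x to selfAdjoint A using IsSelfAdjoint.of_nonneg hx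
    rw [Complex.nonneg_iff, hre, him, hφr]
    exact ⟨hg _ (mem_dominationCone.2 ⟨0, 0, by simpa using hx⟩), rfl⟩
  · change (φr.extendRCLike (((1 : selfAdjoint A)) : A) : ℂ).re ≤ 1
    rw [hre, hφr]
    have := hg (-1, 1) (mem_dominationCone.2 ⟨0, 0, by simp⟩)
    rw [hsplit, ← neg_zero, ← Prod.neg_mk, map_neg] at this
    linarith
  · change _ ≤ (φr.extendRCLike (((⟨star a * a, .star_mul_self a⟩ : selfAdjoint A)) : A) : ℂ).re
    rw [hre, hφr]
    -- With s = |ψ a|² and x = conj(ψ a) a, one has ψ x = s and x⋆x = s a⋆a, so the cone condition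
    -- holds with equality.
    have := hg (⟨star a * a, .star_mul_self a⟩, -‖ψ a‖ ^ 2) (mem_dominationCone.2
      ⟨‖ψ a‖ ^ 2, star (ψ a) • a, by positivity, ?_, ?_, ?_⟩)
    · rw [hsplit] at this
      linarith
    · simp [← Complex.conj_mul']
    · simp
    · simp only [neg_add_cancel, zero_smul, add_zero, star_smul, star_star, smul_mul_smul_comm]
      rw [← Complex.coe_smul]
      simp [← Complex.mul_conj']

end Domination

/-! ### Contractive functionals as coefficients of representations. -/

/-- Riesz representation of a contractive functional in the completion of a pre-Hilbert space. -/
theorem exists_completion_inner_eq {E : Type*} [SeminormedAddCommGroup E] [InnerProductSpace ℂ E]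
    (F : StrongDual ℂ E) (hF : ‖F‖ ≤ 1) :
    ∃ η : UniformSpace.Completion E, ‖η‖ ≤ 1 ∧
      ∀ x : E, inner ℂ η (x : UniformSpace.Completion E) = F x := by
  let e : E →L[ℂ] UniformSpace.Completion E := UniformSpace.Completion.toComplL
  have he : DenseRange e := UniformSpace.Completion.denseRange_coe
  have hFe (x : E) : F.extend e (x : UniformSpace.Completion E) = F x :=
    F.extend_eq he (UniformSpace.Completion.isUniformInducing_coe _) x
  have hG : ‖F.extend e‖ ≤ 1 := by
    refine ContinuousLinearMap.opNorm_le_bound _ zero_le_one fun x => ?_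
    induction x using UniformSpace.Completion.induction_on with
    | hp => exact isClosed_le (by fun_prop) (by fun_prop)
    | ih x =>
      rw [hFe, UniformSpace.Completion.norm_coe]
      exact F.le_of_opNorm_le hF x
  refine ⟨(InnerProductSpace.toDual ℂ _).symm (F.extend e), by simpa using hG, fun x => ?_⟩
  rw [InnerProductSpace.toDual_symm_apply]
  exact hFe x

theorem exists_rep_eq_inner {A : Type u} [CStarAlgebra A] (ψ : StrongDual ℂ A) (hψ : ‖ψ‖ ≤ 1) :
    ∃ (H : Type u) (_ : NormedAddCommGroup H) (_ : InnerProductSpace ℂ H) (_ : CompleteSpace H)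
      (π : A →⋆ₙₐ[ℂ] (H →L[ℂ] H)) (ξ η : H), ‖ξ‖ ≤ 1 ∧ ‖η‖ ≤ 1 ∧
        ∀ a, ψ a = inner ℂ η (π a ξ) := by
  let _ := CStarAlgebra.spectralOrder A
  let _ := CStarAlgebra.spectralOrderedRing A
  obtain ⟨φ, hφ1, hφ⟩ := exists_positiveLinearMap_norm_sq_le ψ hψ
  -- Domination by φ is exactly contractivity of ψ for the GNS seminorm, so Riesz representation
  -- supplies η.
  let F : StrongDual ℂ φ.PreGNS :=
    (ψ.toLinearMap ∘ₗ φ.ofPreGNS.toLinearMap).mkContinuous 1 fun x => by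
      rw [one_mul, φ.preGNS_norm_def]
      exact Real.le_sqrt_of_sq_le (hφ _)
  obtain ⟨η, hη, hηF⟩ :=
    exists_completion_inner_eq F (LinearMap.mkContinuous_norm_le _ zero_le_one _)
  refine ⟨φ.GNS, inferInstance, inferInstance, inferInstance, φ.gnsNonUnitalStarAlgHom,
    (φ.toPreGNS 1 : φ.PreGNS), η, ?_, hη, fun a => ?_⟩
  · rw [UniformSpace.Completion.norm_coe, φ.preGNS_norm_def, Real.sqrt_le_one]
    simpa using hφ1
  · rw [φ.gnsNonUnitalStarAlgHom_apply_coe, hηF]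
    simp [F]

/-- Every contractive functional on a C⋆-algebra is a coefficient of a ⋆-representation, given by
vectors in the unit ball. -/
theorem exists_rep_eq_inner_of_nonUnital {A : Type u} [NonUnitalCStarAlgebra A]
    (ψ : StrongDual ℂ A) (hψ : ‖ψ‖ ≤ 1) :
    ∃ (H : Type u) (_ : NormedAddCommGroup H) (_ : InnerProductSpace ℂ H) (_ : CompleteSpace H)
      (π : A →⋆ₙₐ[ℂ] (H →L[ℂ] H)) (ξ η : H), ‖ξ‖ ≤ 1 ∧ ‖η‖ ≤ 1 ∧
        ∀ a, ψ a = inner ℂ η (π a ξ) := by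
  let ι : A →ₗᵢ[ℂ] Unitization ℂ A :=
    ⟨Unitization.inrHom ℂ ℂ A, fun a => Unitization.norm_inr ..⟩
  obtain ⟨Ψ, hΨ, hn⟩ := exists_extension_norm_eq (LinearMap.range ι.toLinearMap)
    (ψ ∘L (ι.equivRange.symm.toContinuousLinearEquiv : _ →L[ℂ] A))
  have hΨ1 : ‖Ψ‖ ≤ 1 := by
    rw [hn]
    refine ContinuousLinearMap.opNorm_le_bound _ zero_le_one fun x => ?_
    refine (ψ.le_of_opNorm_le hψ _).trans ?_
    simp
  obtain ⟨H, i1, i2, i3, π, ξ, η, hξ, hη, h⟩ := exists_rep_eq_inner Ψ hΨ1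
  refine ⟨H, i1, i2, i3, π.comp (Unitization.inrNonUnitalStarAlgHom ℂ A), ξ, η, hξ, hη,
    fun a => ?_⟩
  have := hΨ (ι.equivRange a)
  simp only [ContinuousLinearMap.comp_apply] at this
  exact (((h _).symm.trans this).trans (by simp)).symm

/-! ### Commutators with projections. -/

theorem Submodule.commute_starProjection_of_invariant {H : Type*} [NormedAddCommGroup H]
    [InnerProductSpace ℂ H] [CompleteSpace H] (K : Submodule ℂ H) [K.HasOrthogonalProjection]
    {T : H →L[ℂ] H} (hT : ∀ x ∈ K, T x ∈ K) (hT' : ∀ x ∈ K, star T x ∈ K) :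
    Commute K.starProjection T := by
  ext x
  change K.starProjection (T x) = T (K.starProjection x)
  refine Submodule.eq_starProjection_of_mem_orthogonal
    (hT _ (K.starProjection_apply_mem x)) ?_
  rw [← map_sub, Submodule.mem_orthogonal]
  intro u hu
  rw [← ContinuousLinearMap.adjoint_inner_left]
  exact (Submodule.mem_orthogonal _ _).1 (K.sub_starProjection_mem_orthogonal x) _ (hT' u hu)

/-- The symmetry u = 2p - 1 is unitary and 2[p, x] = [u, x]; this saves the factor 2 of the triangle
inequality. -/
theorem IsStarProjection.norm_commutator_le {D : Type*} [CStarAlgebra D] {p : D}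
    (hp : IsStarProjection p) (x : D) : ‖p * x - x * p‖ ≤ ‖x‖ := by
  rcases subsingleton_or_nontrivial D with _ | _
  · simp [Subsingleton.elim x 0]
  set u : D := 2 * p - 1 with hu
  have hu1 : ‖u‖ ≤ 1 := (CStarRing.norm_of_mem_unitary hp.two_mul_sub_one_mem_unitary).le
  have h2 : (2 : ℝ) • (p * x - x * p) = u * x - x * u := by
    rw [hu, two_smul]
    noncomm_ring
  have h3 : 2 * ‖p * x - x * p‖ ≤ ‖x‖ + ‖x‖ := by
    rw [← Real.norm_two, ← norm_smul, h2]
    refine (norm_sub_le _ _).trans (add_le_add ?_ ?_)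
    · exact (norm_mul_le _ _).trans (mul_le_of_le_one_left (norm_nonneg _) hu1)
    · exact (norm_mul_le _ _).trans (mul_le_of_le_one_right (norm_nonneg _) hu1)
  linarith

/-! ### The quotient seminorm as a maximum of commutator norms. -/

section QuotientSeminorm

variable {A : Type u} [NonUnitalCStarAlgebra A]

theorem quotientSeminorm_eq_zero_of_mem {B : NonUnitalStarSubalgebra ℂ A} {b : A} (hb : b ∈ B) :
    quotientSeminorm B b = 0 := by
  refine le_antisymm ?_ (apply_nonneg _ _)
  rw [quotientSeminorm_apply]
  exact ciInf_le_of_le ⟨0, Set.forall_mem_range.2 fun _ => norm_nonneg _⟩ ⟨b, hb⟩ (by simp)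

/-- Hahn-Banach for the distance to a subalgebra. -/
theorem exists_dual_eq_quotientSeminorm (B : NonUnitalStarSubalgebra ℂ A) (a : A) :
    ∃ ψ : StrongDual ℂ A, ‖ψ‖ ≤ 1 ∧ (∀ b ∈ B, ψ b = 0) ∧ ψ a = quotientSeminorm B a := by
  let S : Submodule ℂ A := B.toNonUnitalSubalgebra.toSubmodule
  obtain ⟨g, hg, hga⟩ := exists_dual_vector'' ℂ (S.mkQ a)
  refine ⟨(g.toLinearMap ∘ₗ S.mkQ).mkContinuous 1 fun x => ?_,
    LinearMap.mkContinuous_norm_le _ zero_le_one _, fun b hb => ?_, ?_⟩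
  · rw [one_mul]
    refine (g.le_of_opNorm_le hg _).trans ?_
    rw [one_mul]
    exact Submodule.Quotient.norm_mk_le S x
  · have : S.mkQ b = 0 := (Submodule.Quotient.mk_eq_zero S).2 hb
    simp [this]
  · have h : ‖S.mkQ a‖ = quotientSeminorm B a := by
      rw [quotientSeminorm_apply]
      refine (QuotientAddGroup.norm_mk (S := S.toAddSubgroup) a).trans ?_
      rw [Metric.infDist_eq_iInf]
      simp only [dist_eq_norm]
      rfl
    exact hga.trans (congrArg _ h)

/-- A ⋆-representation and a projection commuting with the image of `B` bound the quotient seminorm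
from above by the norm of a commutator. -/
theorem exists_rep_quotientSeminorm_le {B : NonUnitalStarSubalgebra ℂ A}
    (hB : ContainsBoundedApproxIdentity B) (a : A) :
    ∃ (H : Type u) (_ : NormedAddCommGroup H) (_ : InnerProductSpace ℂ H) (_ : CompleteSpace H)
      (π : A →⋆ₙₐ[ℂ] (H →L[ℂ] H)) (p : H →L[ℂ] H), IsStarProjection p ∧
        (∀ b ∈ B, Commute p (π b)) ∧ quotientSeminorm B a ≤ ‖p * π a - π a * p‖ := by
  obtain ⟨l, hl, M, hM⟩ := hB
  obtain ⟨ψ, hψ, hψB, hψa⟩ := exists_dual_eq_quotientSeminorm B a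
  obtain ⟨H, i1, i2, i3, π, ξ, η, hξ, hη, h⟩ := exists_rep_eq_inner_of_nonUnital ψ hψ
  have hπ : Continuous π := AddMonoidHomClass.continuous_of_bound π 1 fun x => by
    simpa using NonUnitalStarAlgHom.norm_apply_le π x
  let K₀ : Submodule ℂ H :=
    { carrier := {x | ∃ b ∈ B, π b ξ = x}
      zero_mem' := ⟨0, zero_mem B, by simp⟩
      add_mem' := by
        rintro _ _ ⟨b, hb, rfl⟩ ⟨c, hc, rfl⟩
        exact ⟨b + c, add_mem hb hc, by simp⟩
      smul_mem' := by
        rintro r _ ⟨b, hb, rfl⟩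
        exact ⟨r • b, SMulMemClass.smul_mem r hb, by simp⟩ }
  let K := K₀.topologicalClosure
  have : CompleteSpace K := K₀.isClosed_topologicalClosure.completeSpace_coe
  have hK (b : A) (hb : b ∈ B) : π b ξ ∈ K := K₀.le_topologicalClosure ⟨b, hb, rfl⟩
  have hinv (b : A) (hb : b ∈ B) (x : H) (hx : x ∈ K) : π b x ∈ K := by
    refine map_mem_closure (π b).continuous hx ?_
    rintro _ ⟨c, hc, rfl⟩
    exact ⟨b * c, mul_mem hb hc, by simp⟩
  have hcomm (b : A) (hb : b ∈ B) : Commute K.starProjection (π b) :=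
    K.commute_starProjection_of_invariant (hinv b hb) (by
      rw [← map_star]
      exact hinv _ (star_mem hb))
  have hηK : η ∈ Kᗮ := by
    rw [Submodule.orthogonal_closure, Submodule.mem_orthogonal']
    rintro _ ⟨b, hb, rfl⟩
    rw [← h, hψB b hb]
  have hlim (x : H) : Filter.Tendsto (fun e => π (a * e) x) l (nhds (π a x)) :=
    (((hπ.clm_apply continuous_const).tendsto a).comp (hl.tendsto_mul_left a))
  -- Although ξ need not lie in K, π(e)pξ = pπ(e)ξ = π(e)ξ for e ∈ B; apply π(a) and let e run along
  -- the approximate identity.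
  have hpξ : π a (K.starProjection ξ) = π a ξ := by
    have := hl.neBot
    refine tendsto_nhds_unique (hlim _) ((hlim ξ).congr' ?_)
    filter_upwards [hM] with e he
    have h1 : π e (K.starProjection ξ) = π e ξ := by
      have := congrArg (fun T : H →L[ℂ] H => T ξ) (hcomm e he.1).eq
      exact this.symm.trans (Submodule.starProjection_eq_self_iff.2 (hK e he.1))
    simp [h1]
  refine ⟨H, i1, i2, i3, π, K.starProjection, isStarProjection_starProjection, hcomm, ?_⟩
  set T := K.starProjection * π a - π a * K.starProjection with hT
  have hin : inner ℂ η (T (K.starProjection ξ)) = -(quotientSeminorm B a : ℂ) := by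
    have h1 : T (K.starProjection ξ) = K.starProjection (π a ξ) - π a ξ := by
      have h2 : K.starProjection (K.starProjection ξ) = K.starProjection ξ :=
        Submodule.starProjection_eq_self_iff.2 (K.starProjection_apply_mem ξ)
      simp [hT, h2, hpξ]
    rw [h1, inner_sub_right, ← h, hψa,
      (Submodule.mem_orthogonal' _ _).1 hηK _ (K.starProjection_apply_mem _), zero_sub]
  calc quotientSeminorm B a = ‖inner ℂ η (T (K.starProjection ξ))‖ := by
        rw [hin, norm_neg, Complex.norm_real, Real.norm_of_nonneg (apply_nonneg _ _)]
    _ ≤ ‖η‖ * ‖T (K.starProjection ξ)‖ := norm_inner_le_norm _ _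
    _ ≤ 1 * (‖T‖ * 1) := by
        gcongr
        refine T.le_opNorm_of_le ((K.norm_starProjection_apply_le ξ).trans hξ)
    _ = ‖T‖ := by ring

theorem norm_commutator_le_quotientSeminorm {B : NonUnitalStarSubalgebra ℂ A} {D : Type*}
    [CStarAlgebra D] (π : A →⋆ₙₐ[ℂ] D) {p : D} (hp : IsStarProjection p)
    (hB : ∀ b ∈ B, Commute p (π b)) (a : A) :
    ‖p * π a - π a * p‖ ≤ quotientSeminorm B a := by
  rw [quotientSeminorm_apply]
  refine le_ciInf fun b => ?_
  have h : p * π a - π a * p = p * π (a - b) - π (a - b) * p := by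
    rw [map_sub, mul_sub, sub_mul, (hB b b.2).eq]
    abel
  rw [h]
  exact (hp.norm_commutator_le _).trans (NonUnitalStarAlgHom.norm_apply_le π _)

theorem isLeibniz_quotientSeminorm {B : NonUnitalStarSubalgebra ℂ A}
    (hB : ContainsBoundedApproxIdentity B) : IsLeibniz (quotientSeminorm B) := by
  intro a c
  obtain ⟨H, _, _, _, π, p, hp, hpB, hle⟩ := exists_rep_quotientSeminorm_le hB (a * c)
  have h : p * π (a * c) - π (a * c) * p
      = (p * π a - π a * p) * π c + π a * (p * π c - π c * p) := by
    rw [map_mul]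
    noncomm_ring
  calc _ ≤ _ := hle
    _ ≤ ‖p * π a - π a * p‖ * ‖π c‖ + ‖π a‖ * ‖p * π c - π c * p‖ := by
        rw [h]
        exact (norm_add_le _ _).trans (add_le_add (norm_mul_le _ _) (norm_mul_le _ _))
    _ ≤ _ := by
        gcongr
        · exact norm_commutator_le_quotientSeminorm π hp hpB a
        · exact NonUnitalStarAlgHom.norm_apply_le π c
        · exact NonUnitalStarAlgHom.norm_apply_le π a
        · exact norm_commutator_le_quotientSeminorm π hp hpB c

end QuotientSeminorm

/-! ### The unital case and inverses. -/

theorem containsBoundedApproxIdentity_of_one_mem {A : Type*} [CStarAlgebra A]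
    {B : NonUnitalStarSubalgebra ℂ A} (h : (1 : A) ∈ B) : ContainsBoundedApproxIdentity B :=
  ⟨pure 1, .pure_one A, ‖(1 : A)‖, by simpa using h⟩

theorem quotientSeminorm_inv_le {A : Type*} [CStarAlgebra A]
    {B : NonUnitalStarSubalgebra ℂ A} (h1 : (1 : A) ∈ B) (u : Aˣ) :
    quotientSeminorm B (↑u⁻¹ : A) ≤ ‖(↑u⁻¹ : A)‖ ^ 2 * quotientSeminorm B (u : A) := by
  obtain ⟨H, _, _, _, π, p, hp, hpB, hle⟩ :=
    exists_rep_quotientSeminorm_le (containsBoundedApproxIdentity_of_one_mem h1) (↑u⁻¹ : A)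
  set v : A := ↑u⁻¹
  have hv : π v * π u = π 1 := by rw [← map_mul, Units.inv_mul]
  have hv' : π u * π v = π 1 := by rw [← map_mul, Units.mul_inv]
  have hl : π 1 * π v = π v := by rw [← map_mul, one_mul]
  have hr : π v * π 1 = π v := by rw [← map_mul, mul_one]
  -- The derivation rule for inverses. As π may be non-unital, π(1) replaces the identity; it
  -- commutes with p because 1 ∈ B.
  have h : p * π v - π v * p = -(π v * (p * π u - π u * p) * π v) := by
    have e1 : π v * (p * π u) * π v = π v * p := by
      rw [← mul_assoc, mul_assoc, hv', mul_assoc, (hpB 1 h1).eq, ← mul_assoc, hr]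
    have e2 : π v * (π u * p) * π v = p * π v := by
      rw [← mul_assoc, hv, ← (hpB 1 h1).eq, mul_assoc, hl]
    rw [mul_sub, sub_mul, e1, e2]
    abel
  calc _ ≤ _ := hle
    _ ≤ ‖π v‖ * ‖p * π u - π u * p‖ * ‖π v‖ := by
        rw [h, norm_neg]
        exact (norm_mul_le _ _).trans (by gcongr; exact norm_mul_le _ _)
    _ ≤ ‖v‖ * quotientSeminorm B (u : A) * ‖v‖ := by
        gcongr
        · exact NonUnitalStarAlgHom.norm_apply_le π v
        · exact norm_commutator_le_quotientSeminorm π hp hpB u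
        · exact NonUnitalStarAlgHom.norm_apply_le π v
    _ = _ := by ring

theorem theorem3p1 :
    (∀ (A : Type*) [NonUnitalCStarAlgebra A] (B : NonUnitalStarSubalgebra ℂ A),
      IsClosed (B : Set A) → ContainsBoundedApproxIdentity B →
        IsLeibniz (quotientSeminorm B)) ∧
    (∀ (A : Type*) [CStarAlgebra A] (B : NonUnitalStarSubalgebra ℂ A),
      IsClosed (B : Set A) → (1 : A) ∈ B →
        IsStronglyLeibniz (quotientSeminorm B)) :=
  ⟨fun _ _ _ _ hB => isLeibniz_quotientSeminorm hB, fun _ _ _ _ h1 =>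
    { isLeibniz := isLeibniz_quotientSeminorm (containsBoundedApproxIdentity_of_one_mem h1)
      map_one := quotientSeminorm_eq_zero_of_mem h1
      map_inv_le := quotientSeminorm_inv_le h1 }⟩
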